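/- Let $\alpha,\beta$ be positive integers. For positive integers $a_1,a_2$ let $w_k=w_k(a_1,a_2)$ ($k\ge 1$) be the sequence with $w_1=a_1$, $w_2=a_2$ and $w_{k+2}=\alpha w_{k+1}+\beta w_k$ for $k\ge 1$. For a positive integer $n$ let $s(n;a_1,a_2)$ be the largest $s\ge 1$ with $w_s(a_1,a_2)=n$ (and $-\infty$ if there is none), and let $s(n)=\max_{a_1,a_2\ge 1}s(n;a_1,a_2)$. A pair $(a_1,a_2)$ of positive integers is called $n$-good if $s(n;a_1,a_2)=s(n)$; let $p(n)\in\{0,1,2,\dots\}\cup\{\infty\}$ be the number of $n$-good pairs, and for an integer $p\ge 0$ let $S_p=\{m\ge 1: p(m)>p\}$. Put $$\gamma=\tfrac12\bigl(\alpha+\sqrt{\alpha^2+4\beta}\bigr),\qquad \lambda=\tfrac12\bigl(\alpha-\sqrt{\alpha^2+4\beta}\bigr),\qquad n_{c,r}=\Bigl\lfloor \frac{c\beta}{(\gamma-\lambda)^2}\,\gamma^{2r+1}\Bigr\rfloor$$ for $c\ge 0$ real and $r$ an integer, and write $[n]=\{1,\dots,n\}$. **Corollary.** Let $\beta=1$ and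 let $\alpha\ge 1$ be an integer. Then for all integers $p$ with $1\le p\le\alpha^2$, all real $c$ with $1\le c\le p\gamma/\alpha$, and all integers $r$ with $n_{c,r}\ge 1$, $$n_{c,r}^{-1}\,|S_p\cap[n_{c,r}]|=\tfrac12 c^{-1}\bigl(1-(\alpha\gamma)^{-1}p\bigr)^2+O(\gamma^{-r}).$$ In particular, for $p=\alpha^2$ and $1\le c\le\alpha\gamma$, $$n_{c,r}^{-1}\,|S_{\alpha^2}\cap[n_{c,r}]|=\tfrac12 c^{-1}\gamma^{-4}+O(\gamma^{-r}).$$ The constants implied by $O(\cdot)$ depend only on $\alpha$ (not on $p$, $c$ or $r$). -/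

import Mathlib

namespace SlowWalk

/-- The `(α, β)`-walk with first term `a₁` and second term `a₂`, indexed from `1`:
`w 1 = a₁`, `w 2 = a₂`, `w (k + 2) = α * w (k + 1) + β * w k` for `k ≥ 1`.
The value at index `0` is a placeholder that is never used. -/
def walk (α β a₁ a₂ : ℕ) : ℕ → ℕ
  | 0 => 0
  | 1 => a₁
  | 2 => a₂
  | k + 3 => α * walk α β a₁ a₂ (k + 2) + β * walk α β a₁ a₂ (k + 1)

/-- `s(n; a₁, a₂)`: the (largest) index `s ≥ 1` at which the walk takes the value `n`,
and `-∞` (that is, `⊥`) if there is no such index. -/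
noncomputable def pairIndex (α β n a₁ a₂ : ℕ) : WithBot ℕ∞ :=
  ⨆ (s : ℕ) (_ : 1 ≤ s ∧ walk α β a₁ a₂ s = n), ((s : ℕ∞) : WithBot ℕ∞)

/-- `s(n)`: the maximum of `s(n; a₁, a₂)` over all pairs of positive integers. -/
noncomputable def slowIndex (α β n : ℕ) : WithBot ℕ∞ :=
  ⨆ (a₁ : ℕ) (a₂ : ℕ) (_ : 1 ≤ a₁ ∧ 1 ≤ a₂), pairIndex α β n a₁ a₂

/-- The pair `(a₁, a₂)` is `n`-good. -/
def IsGood (α β n a₁ a₂ : ℕ) : Prop :=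
  1 ≤ a₁ ∧ 1 ≤ a₂ ∧ slowIndex α β n = pairIndex α β n a₁ a₂

/-- `p(n)`: the number of `n`-good pairs, which may be infinite. -/
noncomputable def numGood (α β n : ℕ) : ℕ∞ :=
  {q : ℕ × ℕ | IsGood α β n q.1 q.2}.encard

/-- `S_p`: the positive integers with strictly more than `p` good pairs. -/
def S (α β p : ℕ) : Set ℕ :=
  {m : ℕ | 1 ≤ m ∧ (p : ℕ∞) < numGood α β m}

/-- `γ`, the larger root of `x ^ 2 = α * x + β`. -/
noncomputable def gam (α β : ℕ) : ℝ := ((α : ℝ) + √((α : ℝ) ^ 2 + 4 * (β : ℝ))) / 2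

/-- `λ`, the smaller root of `x ^ 2 = α * x + β`. -/
noncomputable def lam (α β : ℕ) : ℝ := ((α : ℝ) - √((α : ℝ) ^ 2 + 4 * (β : ℝ))) / 2

/-- `n_{c,r} = ⌊(c β / (γ - λ) ^ 2) γ ^ (2 r + 1)⌋` for `c ≥ 0` real and `r` an integer. -/
noncomputable def nCR (α β : ℕ) (c : ℝ) (r : ℤ) : ℕ :=
  ⌊c * (β : ℝ) / (gam α β - lam α β) ^ 2 * gam α β ^ (2 * r + 1)⌋₊

/-- The proportion `N⁻¹ |S_p ∩ [N]|`, where `[N] = {1, …, N}`. -/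
noncomputable def proportion (α β p N : ℕ) : ℝ :=
  (N : ℝ)⁻¹ * ((S α β p ∩ Set.Icc 1 N).ncard : ℝ)

end SlowWalk

namespace SlowWalk

/-! Write f for `lucasSeq α`. A walk starting with (a, b) takes at index k + 2 the value a f_k + b
f_{k+1}, and shifting a walk shows that the indices at which n can occur form an initial segment. So
n has a unique top level k, and p(n) counts its positive representations n = a f_k + b f_{k+1}. As
f_k and f_{k+1} are coprime, these representations form one progression with step (f_{k+1}, -f_k).
The one with least a satisfies a ≤ f_{k+1}; there are more than p of them iff b > p f_k; and k is
top iff b ≤ αa. Hence the members of S_p at level k correspond to the lattice points of a triangle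
(`isTop_value`, `injOn_value`, `IsTop.exists_value_eq`). The triangle has about (α f_{k+1} - p f_k)²
/ (2α) points, which is a multiple of γ^{2k} up to O(γ^k). Values at levels below r are at most
about γ^{2r+1}/(γ-λ)², those at levels from r on at least about (p/α) γ^{2r+2}/(γ-λ)². The range 1 ≤
c ≤ pγ/α places n_{c,r} between the two, so up to boundedly many integers S_p ∩ [n_{c,r}] is the
union of the levels k < r, and a geometric sum finishes. -/

/-- The sequence `0, 1, α, α ^ 2 + 1, …` with `f (k + 2) = α * f (k + 1) + f k`. -/
def lucasSeq (α : ℕ) : ℕ → ℕ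
  | 0 => 0
  | 1 => 1
  | k + 2 => α * lucasSeq α (k + 1) + lucasSeq α k

theorem lucasSeq_add_two (α k : ℕ) :
    lucasSeq α (k + 2) = α * lucasSeq α (k + 1) + lucasSeq α k := by
  rw [lucasSeq]

theorem walk_add_two (α a b : ℕ) (k : ℕ) :
    walk α 1 a b (k + 2) = a * lucasSeq α k + b * lucasSeq α (k + 1) := by
  induction k using Nat.twoStepInduction with
  | zero => simp [walk, lucasSeq]
  | one => simp [walk, lucasSeq]; ring
  | more k ih1 ih2 =>
    rw [walk, ih2, ih1, lucasSeq_add_two α (k + 1), lucasSeq_add_two α k]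
    ring

theorem one_le_lucasSeq_succ {α : ℕ} (hα : 1 ≤ α) (k : ℕ) : 1 ≤ lucasSeq α (k + 1) := by
  induction k with
  | zero => simp [lucasSeq]
  | succ k ih =>
    rw [lucasSeq_add_two]
    nlinarith [Nat.zero_le (lucasSeq α k)]

theorem monotone_lucasSeq {α : ℕ} (hα : 1 ≤ α) : Monotone (lucasSeq α) := by
  refine monotone_nat_of_le_succ fun k => ?_
  cases k with
  | zero => simp [lucasSeq]
  | succ k =>
    rw [lucasSeq_add_two]
    nlinarith [Nat.zero_le (lucasSeq α k), Nat.zero_le (lucasSeq α (k + 1))]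

theorem le_lucasSeq_add_lucasSeq_succ {α : ℕ} (hα : 1 ≤ α) (k : ℕ) :
    k ≤ lucasSeq α k + lucasSeq α (k + 1) := by
  induction k with
  | zero => simp
  | succ k ih =>
    rw [lucasSeq_add_two]
    nlinarith [one_le_lucasSeq_succ hα k]

theorem coprime_lucasSeq (α k : ℕ) : Nat.Coprime (lucasSeq α (k + 1)) (lucasSeq α k) := by
  induction k with
  | zero => simp [lucasSeq]
  | succ k ih =>
    rw [lucasSeq_add_two]
    exact (Nat.coprime_mul_right_add_left _ _ _).2 ih.symm

/-! ### Representations, top levels and good pairs -/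

/-- The pairs of positive integers whose walk takes the value `n` at index `k + 2`. -/
def reps (α n k : ℕ) : Set (ℕ × ℕ) :=
  {q | 1 ≤ q.1 ∧ 1 ≤ q.2 ∧ q.1 * lucasSeq α k + q.2 * lucasSeq α (k + 1) = n}

/-- Dropping the first term of a walk brings every later value one index earlier. -/
theorem reps_shift {α n k a b : ℕ} (h : (a, b) ∈ reps α n (k + 1)) :
    (b, a + α * b) ∈ reps α n k := by
  obtain ⟨h1, h2, h3⟩ := h
  refine ⟨h2, by simp only at *; omega, ?_⟩
  rw [← h3, lucasSeq_add_two]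
  ring

theorem reps_nonempty_of_le {α n j k : ℕ} (hjk : j ≤ k) (h : (reps α n k).Nonempty) :
    (reps α n j).Nonempty := by
  induction k, hjk using Nat.le_induction with
  | base => exact h
  | succ k _ ih =>
    obtain ⟨⟨a, b⟩, hab⟩ := h
    exact ih ⟨_, reps_shift hab⟩

/-- `k + 2` is the largest index at which some walk takes the value `n`. -/
def IsTop (α n k : ℕ) : Prop := (reps α n k).Nonempty ∧ ¬ (reps α n (k + 1)).Nonempty

theorem IsTop.unique {α n j k : ℕ} (hj : IsTop α n j) (hk : IsTop α n k) : j = k := by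
  rcases lt_trichotomy j k with h | h | h
  · exact absurd (reps_nonempty_of_le h hk.1) hj.2
  · exact h
  · exact absurd (reps_nonempty_of_le h hj.1) hk.2

theorem exists_isTop {α n : ℕ} (hα : 1 ≤ α) (hn : 1 ≤ n) : ∃ k, IsTop α n k := by
  by_contra! hcon
  have key : ∀ k, (reps α n k).Nonempty := by
    intro k
    induction k with
    | zero => exact ⟨(1, n), le_rfl, hn, by simp [lucasSeq]⟩
    | succ k ih =>
      by_contra h
      exact hcon k ⟨ih, h⟩
  obtain ⟨⟨a, b⟩, ha, hb, hab⟩ := key (n + 1)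
  have := le_lucasSeq_add_lucasSeq_succ hα (n + 1)
  simp only at ha hb hab
  nlinarith [Nat.zero_le (lucasSeq α (n + 1)), Nat.zero_le (lucasSeq α (n + 1 + 1))]

theorem IsTop.pairIndex_le {α n k a b : ℕ} (h : IsTop α n k) (ha : 1 ≤ a) (hb : 1 ≤ b) :
    pairIndex α 1 n a b ≤ (((k + 2 : ℕ) : ℕ∞) : WithBot ℕ∞) := by
  refine iSup₂_le fun s hs => ?_
  by_contra hlt
  have hks : k + 2 < s := by
    by_contra hle
    exact hlt (by exact_mod_cast not_lt.1 hle)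
  obtain ⟨m, rfl⟩ : ∃ m, s = m + 2 := ⟨s - 2, by omega⟩
  rw [walk_add_two] at hs
  exact h.2 (reps_nonempty_of_le (k := m) (by omega) ⟨(a, b), ha, hb, hs.2⟩)

theorem le_pairIndex_of_mem_reps {α n k a b : ℕ} (h : (a, b) ∈ reps α n k) :
    (((k + 2 : ℕ) : ℕ∞) : WithBot ℕ∞) ≤ pairIndex α 1 n a b := by
  refine le_iSup₂_of_le (k + 2) ⟨by omega, ?_⟩ le_rfl
  rw [walk_add_two]
  exact h.2.2

theorem IsTop.slowIndex_eq {α n k : ℕ} (h : IsTop α n k) :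
    slowIndex α 1 n = (((k + 2 : ℕ) : ℕ∞) : WithBot ℕ∞) := by
  apply le_antisymm
  · exact iSup_le fun a => iSup_le fun b => iSup_le fun hab => h.pairIndex_le hab.1 hab.2
  · obtain ⟨⟨a, b⟩, hab⟩ := h.1
    refine (le_pairIndex_of_mem_reps hab).trans ?_
    exact le_iSup_of_le a (le_iSup_of_le b (le_iSup_of_le ⟨hab.1, hab.2.1⟩ le_rfl))

theorem IsTop.isGood_iff {α n k a b : ℕ} (h : IsTop α n k) :
    IsGood α 1 n a b ↔ (a, b) ∈ reps α n k := by
  rw [IsGood, h.slowIndex_eq]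
  constructor
  · rintro ⟨ha, hb, hab⟩
    refine ⟨ha, hb, ?_⟩
    by_contra hne
    -- A pair that misses n at index k + 2 has all its occurrences at index at most k + 1, so it
    -- cannot attain the maximum.
    have hle : pairIndex α 1 n a b ≤ (((k + 1 : ℕ) : ℕ∞) : WithBot ℕ∞) := by
      refine iSup₂_le fun s hs => ?_
      have h1 : (((s : ℕ) : ℕ∞) : WithBot ℕ∞) ≤ (((k + 2 : ℕ) : ℕ∞) : WithBot ℕ∞) :=
        (le_iSup₂_of_le s hs le_rfl : _ ≤ pairIndex α 1 n a b).trans (h.pairIndex_le ha hb)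
      have h2 : s ≤ k + 2 := by exact_mod_cast h1
      have h3 : s ≠ k + 2 := by
        rintro rfl
        rw [walk_add_two] at hs
        exact hne hs.2
      have h4 : s ≤ k + 1 := by omega
      exact_mod_cast h4
    rw [← hab] at hle
    have : k + 2 ≤ k + 1 := by exact_mod_cast hle
    omega
  · intro hab
    exact ⟨hab.1, hab.2.1,
      le_antisymm (le_pairIndex_of_mem_reps hab) (h.pairIndex_le hab.1 hab.2.1)⟩

theorem IsTop.numGood_eq {α n k : ℕ} (h : IsTop α n k) :
    numGood α 1 n = (reps α n k).encard := by
  rw [numGood]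
  congr 1
  ext ⟨a, b⟩
  exact h.isGood_iff

/-! ### Members of S_p as lattice points -/

/-- Two representations with the same value differ by a multiple of
`(f (k + 1), - f k)`. -/
theorem exists_eq_add_mul_of_le {α k a b a' b' : ℕ} (hα : 1 ≤ α) (haa : a ≤ a')
    (h : a * lucasSeq α k + b * lucasSeq α (k + 1)
      = a' * lucasSeq α k + b' * lucasSeq α (k + 1)) :
    ∃ t, a' = a + t * lucasSeq α (k + 1) ∧ b = b' + t * lucasSeq α k := by
  obtain ⟨d, rfl⟩ := Nat.exists_eq_add_of_le haa
  have hF := one_le_lucasSeq_succ hα k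
  have hbb : b' ≤ b := by
    by_contra hlt
    have : b * lucasSeq α (k + 1) < b' * lucasSeq α (k + 1) := by nlinarith
    nlinarith [Nat.zero_le (d * lucasSeq α k)]
  obtain ⟨e, rfl⟩ := Nat.exists_eq_add_of_le hbb
  have hde : e * lucasSeq α (k + 1) = d * lucasSeq α k := by nlinarith
  have hdvd : lucasSeq α (k + 1) ∣ d :=
    (coprime_lucasSeq α k).dvd_of_dvd_mul_right ⟨e, by rw [← hde]; ring⟩
  obtain ⟨t, rfl⟩ := hdvd
  refine ⟨t, by ring, ?_⟩
  have : e = t * lucasSeq α k :=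
    Nat.eq_of_mul_eq_mul_right hF (by rw [hde]; ring)
  rw [this]

/-- The lattice points parametrising the members of `S_p` whose largest index is `k + 2`. -/
def triangle (α p k : ℕ) : Finset (Σ _ : ℕ, ℕ) :=
  (Finset.Icc 1 (lucasSeq α (k + 1))).sigma fun a => Finset.Ioc (p * lucasSeq α k) (α * a)

/-- The value at index `k + 2` of the walk starting with the given pair. -/
def value (α k : ℕ) (q : Σ _ : ℕ, ℕ) : ℕ :=
  q.1 * lucasSeq α k + q.2 * lucasSeq α (k + 1)

theorem mem_triangle {α p k : ℕ} {q : Σ _ : ℕ, ℕ} :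
    q ∈ triangle α p k ↔
      (1 ≤ q.1 ∧ q.1 ≤ lucasSeq α (k + 1)) ∧ p * lucasSeq α k < q.2 ∧ q.2 ≤ α * q.1 := by
  simp [triangle]

theorem card_triangle (α p k : ℕ) :
    (triangle α p k).card
      = ∑ a ∈ Finset.Icc 1 (lucasSeq α (k + 1)), (α * a - p * lucasSeq α k) := by
  simp [triangle]

/-- A representation (c, d) one level up shifts to (d, c + αd) here. If d > a, its value would be
too large because b ≤ αa; so a - d is a nonnegative multiple of f_{k+1}, hence 0 as 1 ≤ d ≤ a ≤
f_{k+1}. Then b = c + αa > αa, a contradiction. -/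
theorem isTop_value {α p k : ℕ} (hα : 1 ≤ α) {q : Σ _ : ℕ, ℕ} (hq : q ∈ triangle α p k) :
    IsTop α (value α k q) k := by
  obtain ⟨a, b⟩ := q
  obtain ⟨⟨h1, h2⟩, h3, h4⟩ := mem_triangle.1 hq
  simp only at h1 h2 h3 h4
  refine ⟨⟨(a, b), h1, by simp only; omega, rfl⟩, ?_⟩
  rintro ⟨⟨c, d⟩, hcd⟩
  obtain ⟨hd, -, he⟩ := reps_shift hcd
  have hc : 1 ≤ c := hcd.1
  simp only [value] at hd he
  have hda : d ≤ a := by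
    by_contra hlt
    have h5 : b < c + α * d := by nlinarith
    have hF := one_le_lucasSeq_succ hα k
    have h6 : b * lucasSeq α (k + 1) < (c + α * d) * lucasSeq α (k + 1) := by nlinarith
    have h7 : a * lucasSeq α k ≤ d * lucasSeq α k := Nat.mul_le_mul_right _ (by omega)
    omega
  obtain ⟨t, ht, ht'⟩ := exists_eq_add_mul_of_le hα hda he
  rcases Nat.eq_zero_or_pos t with rfl | htpos
  · simp only [zero_mul, add_zero] at ht ht'
    subst ht
    omega
  · have : lucasSeq α (k + 1) ≤ t * lucasSeq α (k + 1) := Nat.le_mul_of_pos_left _ htpos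
    omega

/-- First coordinates of equal-valued points differ by a multiple of f_{k+1}, and the window 1, …,
f_{k+1} contains each residue once. -/
theorem injOn_value {α p k : ℕ} (hα : 1 ≤ α) :
    Set.InjOn (value α k) (triangle α p k : Set (Σ _ : ℕ, ℕ)) := by
  have key : ∀ q ∈ triangle α p k, ∀ q' ∈ triangle α p k,
      value α k q = value α k q' → q.1 ≤ q'.1 → q = q' := by
    rintro ⟨a, b⟩ hq ⟨a', b'⟩ hq' h hle
    obtain ⟨⟨h1, -⟩, -⟩ := mem_triangle.1 hq
    obtain ⟨⟨-, h2⟩, -⟩ := mem_triangle.1 hq'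
    simp only [value] at h h1 h2 hle
    obtain ⟨t, ht, ht'⟩ := exists_eq_add_mul_of_le hα hle h
    rcases Nat.eq_zero_or_pos t with rfl | htpos
    · simp only [zero_mul, add_zero] at ht ht'
      rw [ht, ht']
    · have : lucasSeq α (k + 1) ≤ t * lucasSeq α (k + 1) := Nat.le_mul_of_pos_left _ htpos
      omega
  intro q hq q' hq' h
  rcases le_total q.1 q'.1 with hle | hle
  · exact key q hq q' hq' h hle
  · exact (key q' hq' q hq h.symm hle).symm

/-- Sliding by t (f_{k+1}, -f_k) for t = 0, …, p keeps the second coordinate positive. -/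
theorem lt_encard_reps {α p k a b : ℕ} (hα : 1 ≤ α) (ha : 1 ≤ a)
    (hb : p * lucasSeq α k < b) :
    (p : ℕ∞) < (reps α (a * lucasSeq α k + b * lucasSeq α (k + 1)) k).encard := by
  set g : ℕ → ℕ × ℕ := fun t => (a + t * lucasSeq α (k + 1), b - t * lucasSeq α k) with hg
  have hF := one_le_lucasSeq_succ hα k
  have hinj : Function.Injective g := by
    intro t t' h
    have h1 : a + t * lucasSeq α (k + 1) = a + t' * lucasSeq α (k + 1) := congrArg Prod.fst h
    exact Nat.eq_of_mul_eq_mul_right hF (Nat.add_left_cancel h1)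
  have hsub : ((Finset.range (p + 1)).image g : Set (ℕ × ℕ)) ⊆
      reps α (a * lucasSeq α k + b * lucasSeq α (k + 1)) k := by
    intro q hq
    simp only [Finset.coe_image, Set.mem_image, Finset.coe_range, Set.mem_Iio] at hq
    obtain ⟨t, ht, rfl⟩ := hq
    have h1 : t * lucasSeq α k ≤ p * lucasSeq α k := Nat.mul_le_mul_right _ (by omega)
    obtain ⟨e, he⟩ := Nat.exists_eq_add_of_le (h1.trans hb.le)
    refine ⟨by simp only [hg]; omega, by simp only [hg]; omega, ?_⟩
    have : b - t * lucasSeq α k = e := by omega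
    simp only [hg, this]
    rw [he]
    ring
  have h2 := Set.encard_le_encard hsub
  rw [Set.encard_coe_eq_coe_finsetCard, Finset.card_image_of_injective _ hinj,
    Finset.card_range] at h2
  refine lt_of_lt_of_le ?_ h2
  exact_mod_cast Nat.lt_succ_self p

theorem IsTop.exists_value_eq {α n p k : ℕ} (hα : 1 ≤ α) (h : IsTop α n k)
    (hp : (p : ℕ∞) < (reps α n k).encard) :
    ∃ q ∈ triangle α p k, value α k q = n := by
  classical
  have hex : ∃ a, ∃ b, (a, b) ∈ reps α n k := by
    obtain ⟨⟨a, b⟩, hab⟩ := h.1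
    exact ⟨a, b, hab⟩
  -- The witness is the representation with least first coordinate: minimality, the count and
  -- topness each give one side of the triangle.
  obtain ⟨b, hab⟩ := Nat.find_spec hex
  have hmin : ∀ a' b', (a', b') ∈ reps α n k → Nat.find hex ≤ a' :=
    fun a' b' h' => Nat.find_min' hex ⟨b', h'⟩
  generalize Nat.find hex = a at hab hmin
  obtain ⟨ha, hb, hv⟩ := hab
  simp only at ha hb hv
  refine ⟨⟨a, b⟩, mem_triangle.2 ⟨⟨ha, ?_⟩, ?_, ?_⟩, hv⟩ <;> simp only
  · by_contra hlt
    have h1 := hmin (a - lucasSeq α (k + 1)) (b + lucasSeq α k) ⟨by simp only; omega,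
      by simp only; omega, by
        obtain ⟨d, rfl⟩ := Nat.exists_eq_add_of_le (not_le.1 hlt).le
        simp only [Nat.add_sub_cancel_left]
        rw [← hv]
        ring⟩
    have hF := one_le_lucasSeq_succ hα k
    omega
  · by_contra hle
    -- If b ≤ p f_k, only shifts t < p leave the second coordinate positive, so there are at most p
    -- representations.
    have hsub : reps α n k ⊆ ((Finset.range p).image
        fun t => (a + t * lucasSeq α (k + 1), b - t * lucasSeq α k) : Finset (ℕ × ℕ)) := by
      rintro ⟨a', b'⟩ h'
      obtain ⟨t, ht, ht'⟩ := exists_eq_add_mul_of_le hα (hmin a' b' h') (hv.trans h'.2.2.symm)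
      have hb' : 1 ≤ b' := h'.2.1
      simp only [Finset.coe_image, Set.mem_image, Finset.coe_range, Set.mem_Iio]
      refine ⟨t, ?_, by rw [← ht, ht', Nat.add_sub_cancel]⟩
      by_contra htp
      have : p * lucasSeq α k ≤ t * lucasSeq α k := Nat.mul_le_mul_right _ (by omega)
      omega
    have h2 := Set.encard_le_encard hsub
    rw [Set.encard_coe_eq_coe_finsetCard] at h2
    have h3 : ((Finset.range p).image
        fun t => (a + t * lucasSeq α (k + 1), b - t * lucasSeq α k)).card ≤ p :=
      Finset.card_image_le.trans (by simp)
    have h4 : (reps α n k).encard ≤ (p : ℕ∞) := h2.trans (by exact_mod_cast h3)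
    exact absurd hp (not_lt.2 h4)
  · by_contra hlt
    -- Running the recurrence backwards would prepend the positive term b - αa, contradicting
    -- topness.
    refine h.2 ⟨(b - α * a, a), by simp only; omega, ha, ?_⟩
    obtain ⟨d, rfl⟩ := Nat.exists_eq_add_of_le (not_le.1 hlt).le
    simp only [Nat.add_sub_cancel_left]
    rw [← hv, lucasSeq_add_two]
    ring

/-! ### Levels of S_p and their position relative to N -/

/-- The members of `S_p` whose largest index is `k + 2`. -/
def layer (α p k : ℕ) : Finset ℕ := (triangle α p k).image (value α k)

theorem card_layer {α p k : ℕ} (hα : 1 ≤ α) : (layer α p k).card = (triangle α p k).card :=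
  Finset.card_image_of_injOn (injOn_value hα)

theorem IsTop.of_mem_layer {α p k n : ℕ} (hα : 1 ≤ α) (h : n ∈ layer α p k) :
    IsTop α n k := by
  obtain ⟨q, hq, rfl⟩ := Finset.mem_image.1 h
  exact isTop_value hα hq

theorem mem_S_iff {α p n : ℕ} (hα : 1 ≤ α) : n ∈ S α 1 p ↔ ∃ k, n ∈ layer α p k := by
  constructor
  · rintro ⟨hn, hp⟩
    obtain ⟨k, hk⟩ := exists_isTop hα hn
    rw [hk.numGood_eq] at hp
    exact ⟨k, Finset.mem_image.2 (hk.exists_value_eq hα hp)⟩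
  · rintro ⟨k, hk⟩
    have ht := IsTop.of_mem_layer hα hk
    obtain ⟨⟨a, b⟩, hq, rfl⟩ := Finset.mem_image.1 hk
    obtain ⟨⟨h1, -⟩, h2, -⟩ := mem_triangle.1 hq
    have hF := one_le_lucasSeq_succ hα k
    simp only at h1 h2
    refine ⟨?_, ?_⟩
    · simp only [value]
      nlinarith [Nat.zero_le (a * lucasSeq α k)]
    · rw [ht.numGood_eq]
      exact lt_encard_reps hα h1 h2

theorem le_of_mem_layer {α p k n : ℕ} (h : n ∈ layer α p k) :
    n ≤ lucasSeq α (k + 1) * lucasSeq α (k + 2) := by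
  obtain ⟨⟨a, b⟩, hq, rfl⟩ := Finset.mem_image.1 h
  obtain ⟨⟨-, h1⟩, -, h2⟩ := mem_triangle.1 hq
  simp only at h1 h2
  calc value α k ⟨a, b⟩ ≤ a * lucasSeq α k + α * a * lucasSeq α (k + 1) :=
        Nat.add_le_add_left (Nat.mul_le_mul_right _ h2) _
    _ = a * lucasSeq α (k + 2) := by rw [lucasSeq_add_two]; ring
    _ ≤ _ := Nat.mul_le_mul_right _ h1

/-- Since αa ≥ b, the value satisfies αn ≥ b (f_k + α f_{k+1}) = b f_{k+2}, and b > p f_k. -/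
theorem le_mul_of_mem_layer {α p k n : ℕ} (h : n ∈ layer α p k) :
    p * lucasSeq α k * lucasSeq α (k + 2) ≤ α * n := by
  obtain ⟨⟨a, b⟩, hq, rfl⟩ := Finset.mem_image.1 h
  obtain ⟨-, h1, h2⟩ := mem_triangle.1 hq
  simp only at h1 h2
  calc p * lucasSeq α k * lucasSeq α (k + 2) ≤ b * lucasSeq α (k + 2) :=
        Nat.mul_le_mul_right _ h1.le
    _ = b * lucasSeq α k + α * (b * lucasSeq α (k + 1)) := by rw [lucasSeq_add_two]; ring
    _ ≤ α * a * lucasSeq α k + α * (b * lucasSeq α (k + 1)) :=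
        Nat.add_le_add_right (Nat.mul_le_mul_right _ h2) _
    _ = _ := by simp only [value]; ring

theorem card_biUnion_layer {α p : ℕ} (hα : 1 ≤ α) (r : ℕ) :
    ((Finset.range r).biUnion (layer α p)).card
      = ∑ k ∈ Finset.range r, (triangle α p k).card := by
  rw [Finset.card_biUnion]
  · exact Finset.sum_congr rfl fun k _ => card_layer hα
  · intro j _ k _ hjk
    rw [Function.onFun, Finset.disjoint_left]
    exact fun n hj hk => hjk ((IsTop.of_mem_layer hα hj).unique (IsTop.of_mem_layer hα hk))

/-- Levels below r can leave [N] only at N + 1, and levels from r on can enter it only in the α + 1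
integers from N - α to N. This slack absorbs the rounding of N and the Binet errors. -/
theorem abs_ncard_sub_sum_le {α p r N : ℕ} (hα : 1 ≤ α)
    (hup : lucasSeq α r * lucasSeq α (r + 1) ≤ N + 1)
    (hlow : ∀ n, n ≤ N → p * lucasSeq α r * lucasSeq α (r + 2) ≤ α * n → N ≤ n + α) :
    |((S α 1 p ∩ Set.Icc 1 N).ncard : ℝ)
      - ∑ k ∈ Finset.range r, ((triangle α p k).card : ℝ)| ≤ α + 1 := by
  set U := (Finset.range r).biUnion (layer α p) with hU
  have hfin : (S α 1 p ∩ Set.Icc 1 N).Finite := (Set.finite_Icc 1 N).inter_of_right _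
  have hcard := card_biUnion_layer (p := p) hα r
  rw [← hU] at hcard
  have h1 : S α 1 p ∩ Set.Icc 1 N ⊆ (U ∪ Finset.Icc (N - α) N : Finset ℕ) := by
    rintro n ⟨hn, hn1, hnN⟩
    obtain ⟨k, hk⟩ := (mem_S_iff hα).1 hn
    simp only [Finset.coe_union, Set.mem_union, Finset.mem_coe, Finset.mem_Icc]
    rcases lt_or_ge k r with hkr | hkr
    · exact Or.inl (Finset.mem_biUnion.2 ⟨k, Finset.mem_range.2 hkr, hk⟩)
    · right
      have h2 : p * lucasSeq α r * lucasSeq α (r + 2) ≤ α * n :=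
        (Nat.mul_le_mul (Nat.mul_le_mul_left _ (monotone_lucasSeq hα hkr))
          (monotone_lucasSeq hα (by omega))).trans (le_mul_of_mem_layer hk)
      have := hlow n hnN h2
      omega
  have h2 : (U : Set ℕ) ⊆ (S α 1 p ∩ Set.Icc 1 N) ∪ {N + 1} := by
    intro n hn
    obtain ⟨k, hkr, hk⟩ := Finset.mem_biUnion.1 hn
    rw [Finset.mem_range] at hkr
    have hS : n ∈ S α 1 p := (mem_S_iff hα).2 ⟨k, hk⟩
    have h3 : n ≤ N + 1 := ((le_of_mem_layer hk).trans
      (Nat.mul_le_mul (monotone_lucasSeq hα (by omega)) (monotone_lucasSeq hα (by omega)))).trans hup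
    rcases Nat.lt_or_ge N n with h4 | h4
    · right
      exact le_antisymm h3 h4
    · exact Or.inl ⟨hS, hS.1, h4⟩
  have h3 : (S α 1 p ∩ Set.Icc 1 N).ncard ≤ U.card + (α + 1) := by
    have := Set.ncard_le_ncard h1 (Finset.finite_toSet _)
    rw [Set.ncard_coe_finset] at this
    refine this.trans ((Finset.card_union_le _ _).trans ?_)
    rw [Nat.card_Icc]
    omega
  have h4 : U.card ≤ (S α 1 p ∩ Set.Icc 1 N).ncard + 1 := by
    have := Set.ncard_le_ncard h2 (hfin.union (Set.finite_singleton _))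
    rw [Set.ncard_coe_finset] at this
    refine this.trans ((Set.ncard_union_le _ _).trans ?_)
    rw [Set.ncard_singleton]
  rw [hcard] at h3 h4
  have h3' : ((S α 1 p ∩ Set.Icc 1 N).ncard : ℝ)
      ≤ ∑ k ∈ Finset.range r, ((triangle α p k).card : ℝ) + (α + 1) := by exact_mod_cast h3
  have h4' : ∑ k ∈ Finset.range r, ((triangle α p k).card : ℝ)
      ≤ ((S α 1 p ∩ Set.Icc 1 N).ncard : ℝ) + 1 := by exact_mod_cast h4
  have hα' : (0 : ℝ) ≤ α := Nat.cast_nonneg α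
  rw [abs_le]
  constructor <;> linarith

/-! ### The roots γ, λ and Binet estimates -/

theorem gam_add_lam (α : ℕ) : gam α 1 + lam α 1 = α := by
  unfold gam lam; ring

theorem gam_mul_lam (α : ℕ) : gam α 1 * lam α 1 = -1 := by
  have h : √((α : ℝ) ^ 2 + 4 * ((1 : ℕ) : ℝ)) ^ 2 = (α : ℝ) ^ 2 + 4 * ((1 : ℕ) : ℝ) :=
    Real.sq_sqrt (by positivity)
  unfold gam lam
  push_cast at *
  linear_combination (-1 / 4) * h

theorem gam_sq (α : ℕ) : gam α 1 ^ 2 = α * gam α 1 + 1 := by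
  linear_combination gam α 1 * gam_add_lam α - gam_mul_lam α

theorem lam_sq (α : ℕ) : lam α 1 ^ 2 = α * lam α 1 + 1 := by
  linear_combination lam α 1 * gam_add_lam α - gam_mul_lam α

theorem gam_sub_lam_sq (α : ℕ) : (gam α 1 - lam α 1) ^ 2 = (α : ℝ) ^ 2 + 4 := by
  rw [← gam_add_lam α]
  linear_combination -4 * gam_mul_lam α

theorem lt_gam (α : ℕ) : (α : ℝ) < gam α 1 := by
  have h : 0 < gam α 1 := by
    unfold gam
    positivity
  nlinarith [gam_add_lam α, gam_mul_lam α]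

theorem one_lt_gam {α : ℕ} (hα : 1 ≤ α) : 1 < gam α 1 :=
  lt_of_le_of_lt (by exact_mod_cast hα) (lt_gam α)

theorem lam_neg {α : ℕ} (hα : 1 ≤ α) : lam α 1 < 0 := by
  nlinarith [gam_mul_lam α, one_lt_gam hα]

theorem abs_lam_le_one {α : ℕ} (hα : 1 ≤ α) : |lam α 1| ≤ 1 := by
  rw [abs_le]
  constructor
  · nlinarith [gam_mul_lam α, one_lt_gam hα, lam_neg hα]
  · linarith [lam_neg hα]

theorem lucasSeq_binet (α k : ℕ) :
    (lucasSeq α k : ℝ) * (gam α 1 - lam α 1) = gam α 1 ^ k - lam α 1 ^ k := by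
  induction k using Nat.twoStepInduction with
  | zero => simp [lucasSeq]
  | one => simp [lucasSeq]
  | more k ih1 ih2 =>
    rw [lucasSeq_add_two]
    push_cast
    linear_combination α * ih2 + ih1 - gam α 1 ^ k * gam_sq α + lam α 1 ^ k * lam_sq α

theorem lucasSeq_succ_le (α k : ℕ) (hα : 1 ≤ α) : (lucasSeq α (k + 1) : ℝ) ≤ gam α 1 ^ k := by
  have hg := one_lt_gam hα
  induction k using Nat.twoStepInduction with
  | zero => simp [lucasSeq]
  | one => simpa [lucasSeq] using (lt_gam α).le
  | more k ih1 ih2 =>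
    rw [lucasSeq_add_two]
    push_cast
    have : gam α 1 ^ (k + 2) = α * gam α 1 ^ (k + 1) + gam α 1 ^ k := by
      linear_combination gam α 1 ^ k * gam_sq α
    rw [this]
    gcongr

theorem lucasSeq_mul_succ_le {α : ℕ} (hα : 1 ≤ α) (r : ℕ) :
    (lucasSeq α r * lucasSeq α (r + 1) : ℝ)
      ≤ gam α 1 ^ (2 * r + 1) / (gam α 1 - lam α 1) ^ 2 + 1 := by
  have h1 := lucasSeq_binet α r
  have h2 := lucasSeq_binet α (r + 1)
  have hD := gam_sub_lam_sq α
  have hα' : (1 : ℝ) ≤ α := by exact_mod_cast hα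
  have hpos : 0 < (gam α 1 - lam α 1) ^ 2 := by rw [hD]; positivity
  rw [div_add_one hpos.ne', le_div_iff₀ hpos]
  have h3 : (lucasSeq α r * lucasSeq α (r + 1) : ℝ) * (gam α 1 - lam α 1) ^ 2
      = (gam α 1 ^ r - lam α 1 ^ r) * (gam α 1 ^ (r + 1) - lam α 1 ^ (r + 1)) := by
    rw [← h1, ← h2]; ring
  have h4 : (gam α 1 ^ r - lam α 1 ^ r) * (gam α 1 ^ (r + 1) - lam α 1 ^ (r + 1))
      = gam α 1 ^ (2 * r + 1) + (lam α 1 ^ r) ^ 2 * lam α 1 - (-1) ^ r * α := by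
    rw [← gam_mul_lam α, ← gam_add_lam α, mul_pow]; ring
  rw [h3, h4, hD]
  have h5 : (lam α 1 ^ r) ^ 2 * lam α 1 ≤ 0 :=
    mul_nonpos_of_nonneg_of_nonpos (sq_nonneg _) (lam_neg hα).le
  have h6 : -((-1 : ℝ) ^ r * α) ≤ α := by
    rcases neg_one_pow_eq_or ℝ r with h | h <;> rw [h] <;> linarith
  nlinarith

theorem le_lucasSeq_mul_add_two (α : ℕ) (r : ℕ) :
    gam α 1 ^ (2 * r + 2) / (gam α 1 - lam α 1) ^ 2 - 1
      ≤ (lucasSeq α r * lucasSeq α (r + 2) : ℝ) := by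
  have h1 := lucasSeq_binet α r
  have h2 := lucasSeq_binet α (r + 2)
  have hD := gam_sub_lam_sq α
  have hpos : 0 < (gam α 1 - lam α 1) ^ 2 := by rw [hD]; positivity
  rw [div_sub_one hpos.ne', div_le_iff₀ hpos]
  have h3 : (lucasSeq α r * lucasSeq α (r + 2) : ℝ) * (gam α 1 - lam α 1) ^ 2
      = (gam α 1 ^ r - lam α 1 ^ r) * (gam α 1 ^ (r + 2) - lam α 1 ^ (r + 2)) := by
    rw [← h1, ← h2]; ring
  have h7 : gam α 1 ^ 2 + lam α 1 ^ 2 = (α : ℝ) ^ 2 + 2 := by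
    rw [← gam_add_lam α]; linear_combination -2 * gam_mul_lam α
  have h4 : (gam α 1 ^ r - lam α 1 ^ r) * (gam α 1 ^ (r + 2) - lam α 1 ^ (r + 2))
      = gam α 1 ^ (2 * r + 2) + (lam α 1 ^ (r + 1)) ^ 2 - (-1) ^ r * ((α : ℝ) ^ 2 + 2) := by
    rw [← h7, ← gam_mul_lam α, mul_pow]; ring
  rw [h3, h4, hD]
  have h6 : (-1 : ℝ) ^ r * ((α : ℝ) ^ 2 + 2) ≤ (α : ℝ) ^ 2 + 2 := by
    rcases neg_one_pow_eq_or ℝ r with h | h <;> rw [h] <;> nlinarith [sq_nonneg (α : ℝ)]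
  nlinarith [sq_nonneg (lam α 1 ^ (r + 1))]

/-! ### Counting lattice points in the triangles -/

/-- The sum of the truncated differences is compared with the area of a right triangle of height αF
- q and slope α; each new column costs an error of at most α. -/
theorem sum_Icc_tsub_bounds {α : ℕ} (hα : 1 ≤ α) (q F : ℕ) :
    (((α * F - q : ℕ) : ℝ) ^ 2 / (2 * α) ≤ ((∑ a ∈ Finset.Icc 1 F, (α * a - q) : ℕ) : ℝ)) ∧
    (((∑ a ∈ Finset.Icc 1 F, (α * a - q) : ℕ) : ℝ)
      ≤ ((α * F - q : ℕ) : ℝ) ^ 2 / (2 * α) + α * F) := by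
  have hα' : (1 : ℝ) ≤ α := by exact_mod_cast hα
  induction F with
  | zero => simp
  | succ F ih =>
    rw [Finset.sum_Icc_succ_top (by omega)]
    obtain ⟨ih1, ih2⟩ := ih
    push_cast at ih1 ih2 ⊢
    set x : ℕ := α * F - q with hx
    set y : ℕ := α * (F + 1) - q with hy
    have hxy : x ≤ y := by
      rw [hx, hy]; exact Nat.sub_le_sub_right (Nat.mul_le_mul_left _ (by omega)) _
    have hyx : y ≤ x + α := by rw [hx, hy, Nat.mul_succ]; omega
    -- Either the truncation is no longer active and the height grows by exactly α, or the previous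
    -- height was 0.
    have hyx' : y = x + α ∨ x = 0 := by rw [hx, hy, Nat.mul_succ]; omega
    have hxr : (0 : ℝ) ≤ x := Nat.cast_nonneg x
    have hxyr : (x : ℝ) ≤ y := by exact_mod_cast hxy
    have hyxr : (y : ℝ) ≤ x + α := by exact_mod_cast hyx
    have hd1 : (y : ℝ) ^ 2 / (2 * α) ≤ (x : ℝ) ^ 2 / (2 * α) + y := by
      rw [div_add' _ _ _ (by positivity), div_le_div_iff_of_pos_right (by positivity)]
      nlinarith
    have hd2 : (x : ℝ) ^ 2 / (2 * α) + y ≤ (y : ℝ) ^ 2 / (2 * α) + α := by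
      rw [div_add' _ _ _ (by positivity), div_add' _ _ _ (by positivity),
        div_le_div_iff_of_pos_right (by positivity)]
      rcases hyx' with h | h
      · have : (y : ℝ) = x + α := by exact_mod_cast h
        rw [this]; nlinarith
      · have : (x : ℝ) = 0 := by exact_mod_cast h
        rw [this] at hyxr ⊢; nlinarith [sq_nonneg (y : ℝ)]
    constructor
    · linarith
    · linarith

theorem mul_lucasSeq_le {α p : ℕ} (hp : p ≤ α ^ 2) (k : ℕ) :
    p * lucasSeq α k ≤ α * lucasSeq α (k + 1) := by
  cases k with
  | zero => simp [lucasSeq]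
  | succ k =>
    rw [lucasSeq_add_two]
    calc p * lucasSeq α (k + 1) ≤ α ^ 2 * lucasSeq α (k + 1) := Nat.mul_le_mul_right _ hp
      _ ≤ _ := by rw [mul_add, pow_two, mul_assoc]; exact Nat.le_add_right _ _

/-- Used with G = γ^k and L = λ^k: since |GL| = 1, the cross term stays bounded although G grows. -/
theorem abs_sq_sub_sq_le {y u w G L B : ℝ} (hu : |u| ≤ B) (hw : |w| ≤ 2 * B)
    (hGL : |G * L| = 1) (hL : |L| ≤ 1) (hy : y = u * G - w * L) :
    |y ^ 2 - (u * G) ^ 2| ≤ 8 * B ^ 2 := by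
  have hB : 0 ≤ B := (abs_nonneg u).trans hu
  have h : y ^ 2 - (u * G) ^ 2 = -2 * (u * w * (G * L)) + w ^ 2 * L ^ 2 := by rw [hy]; ring
  have h1 : |u * w * (G * L)| ≤ B * (2 * B) := by
    rw [abs_mul, hGL, mul_one, abs_mul]
    gcongr
  have h2 : |w ^ 2 * L ^ 2| ≤ (2 * B) ^ 2 * 1 ^ 2 := by
    rw [abs_mul, abs_pow, abs_pow]
    gcongr
  rw [h]
  refine (abs_add_le _ _).trans ?_
  rw [abs_mul, show |(-2 : ℝ)| = 2 by norm_num]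
  linarith

/-- The Binet error is bounded; the factor γ^k comes from the column error α f_{k+1}. -/
theorem abs_card_triangle_sub_le {α p : ℕ} (hα : 1 ≤ α) (hp : p ≤ α ^ 2) (k : ℕ) :
    |((triangle α p k).card : ℝ)
      - (α * gam α 1 - p) ^ 2 / (2 * α * (gam α 1 - lam α 1) ^ 2) * (gam α 1 ^ k) ^ 2|
      ≤ (8 * α ^ 2 * gam α 1 ^ 2 + α) * gam α 1 ^ k := by
  have hα' : (1 : ℝ) ≤ α := by exact_mod_cast hα
  have hg := one_lt_gam hα
  have hp' : (p : ℝ) ≤ α ^ 2 := by exact_mod_cast hp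
  have hp0 : (0 : ℝ) ≤ p := Nat.cast_nonneg p
  have hαg := lt_gam α
  have hgk : 1 ≤ gam α 1 ^ k := one_le_pow₀ hg.le
  have hl := abs_lam_le_one hα
  have hlk : |lam α 1 ^ k| ≤ 1 := by rw [abs_pow]; exact pow_le_one₀ (abs_nonneg _) hl
  have hgl : gam α 1 ^ k * lam α 1 ^ k = (-1) ^ k := by rw [← mul_pow, gam_mul_lam]
  have hF := lucasSeq_succ_le α k hα
  obtain ⟨hb1, hb2⟩ := sum_Icc_tsub_bounds hα (p * lucasSeq α k) (lucasSeq α (k + 1))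
  rw [← card_triangle, Nat.cast_sub (mul_lucasSeq_le hp k)] at hb1 hb2
  push_cast at hb1 hb2
  have hD := gam_sub_lam_sq α
  have hpos : 5 ≤ (gam α 1 - lam α 1) ^ 2 := by rw [hD]; nlinarith
  have hx : (α * (lucasSeq α (k + 1) : ℝ) - p * lucasSeq α k) * (gam α 1 - lam α 1)
      = (α * gam α 1 - p) * gam α 1 ^ k - (α * lam α 1 - p) * lam α 1 ^ k := by
    linear_combination α * lucasSeq_binet α (k + 1) - p * lucasSeq_binet α k
  set x : ℝ := α * (lucasSeq α (k + 1) : ℝ) - p * lucasSeq α k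
  set D : ℝ := gam α 1 - lam α 1
  set g := gam α 1
  set u : ℝ := α * g - p with hu
  set w : ℝ := α * lam α 1 - p with hw
  have hu0 : |u| ≤ α * g := by rw [abs_le]; constructor <;> nlinarith
  have hw0 : |w| ≤ 2 * (α * g) := by
    obtain ⟨h1, h2⟩ := abs_le.1 hl
    rw [abs_le]; constructor <;> nlinarith
  have h4 : |x ^ 2 / (2 * α) - u ^ 2 / (2 * α * D ^ 2) * (g ^ k) ^ 2| ≤ 8 * α ^ 2 * g ^ 2 := by
    have hDne : D ^ 2 ≠ 0 := (lt_of_lt_of_le (by norm_num) hpos).ne'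
    have hden : 1 * 1 ≤ (2 * (α : ℝ)) * D ^ 2 :=
      mul_le_mul (by linarith) (by linarith) zero_le_one (by linarith)
    have h3 := abs_sq_sub_sq_le hu0 hw0 (by rw [hgl, abs_pow, abs_neg, abs_one, one_pow]) hlk hx
    have : x ^ 2 / (2 * α) - u ^ 2 / (2 * α * D ^ 2) * (g ^ k) ^ 2
        = ((x * D) ^ 2 - (u * g ^ k) ^ 2) / (2 * α * D ^ 2) := by
      rw [mul_pow, mul_pow]
      generalize D ^ 2 = d at hDne
      field_simp
    rw [this, abs_div, abs_of_pos (show 0 < 2 * α * D ^ 2 by linarith)]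
    refine (div_le_self (abs_nonneg _) (by linarith)).trans (h3.trans_eq (by ring))
  have h5 : 8 * α ^ 2 * g ^ 2 ≤ 8 * α ^ 2 * g ^ 2 * g ^ k :=
    le_mul_of_one_le_right (by positivity) hgk
  have h6 : (α : ℝ) * lucasSeq α (k + 1) ≤ α * g ^ k := by gcongr
  have h7 : 0 ≤ α * g ^ k := by positivity
  rw [abs_le] at h4 ⊢
  rw [add_mul]
  constructor <;> linarith [h4.1, h4.2]

theorem abs_sum_card_triangle_sub_le {α p : ℕ} (hα : 1 ≤ α) (hp : p ≤ α ^ 2) (r : ℕ) :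
    |∑ k ∈ Finset.range r, ((triangle α p k).card : ℝ)
      - (1 - ((α : ℝ) * gam α 1)⁻¹ * p) ^ 2 / (2 * (gam α 1 - lam α 1) ^ 2)
        * gam α 1 ^ (2 * r + 1)|
      ≤ (gam α 1 + (8 * α ^ 2 * gam α 1 ^ 2 + α) / (gam α 1 - 1)) * gam α 1 ^ r := by
  have hα' : (1 : ℝ) ≤ α := by exact_mod_cast hα
  have hg := one_lt_gam hα
  have hp' : (p : ℝ) ≤ α ^ 2 := by exact_mod_cast hp
  have hp0 : (0 : ℝ) ≤ p := Nat.cast_nonneg p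
  have hαg := lt_gam α
  have hD := gam_sub_lam_sq α
  have hgsq := gam_sq α
  have hpos : 5 ≤ (gam α 1 - lam α 1) ^ 2 := by rw [hD]; nlinarith
  induction r with
  | zero =>
    have h1 : ((α : ℝ) * gam α 1)⁻¹ * p ≤ 1 := by
      rw [inv_mul_le_iff₀ (by positivity)]; nlinarith
    have h2 : 0 ≤ ((α : ℝ) * gam α 1)⁻¹ * p := by positivity
    have h3 : (1 - ((α : ℝ) * gam α 1)⁻¹ * p) ^ 2 ≤ 1 := by
      apply pow_le_one₀ <;> linarith
    have h4 : (1 - ((α : ℝ) * gam α 1)⁻¹ * p) ^ 2 / (2 * (gam α 1 - lam α 1) ^ 2) ≤ 1 := by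
      rw [div_le_one (by positivity)]; linarith
    have h5 : 0 ≤ (8 * α ^ 2 * gam α 1 ^ 2 + α) / (gam α 1 - 1) :=
      div_nonneg (by positivity) (by linarith)
    simp only [Finset.range_zero, Finset.sum_empty, zero_sub, abs_neg, mul_zero, zero_add,
      pow_one, pow_zero, mul_one]
    rw [abs_of_nonneg (by positivity)]
    nlinarith
  | succ r ih =>
    rw [Finset.sum_range_succ]
    have hstep := abs_card_triangle_sub_le hα hp r
    have hid : (1 - ((α : ℝ) * gam α 1)⁻¹ * p) ^ 2 / (2 * (gam α 1 - lam α 1) ^ 2)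
        * gam α 1 ^ (2 * (r + 1) + 1)
        = (1 - ((α : ℝ) * gam α 1)⁻¹ * p) ^ 2 / (2 * (gam α 1 - lam α 1) ^ 2)
          * gam α 1 ^ (2 * r + 1)
        + (α * gam α 1 - p) ^ 2 / (2 * α * (gam α 1 - lam α 1) ^ 2) * (gam α 1 ^ r) ^ 2 := by
      -- The main terms telescope because γ² - 1 = αγ.
      have e1 : gam α 1 ^ (2 * (r + 1) + 1)
          = gam α 1 ^ (2 * r + 1) + α * gam α 1 * gam α 1 * (gam α 1 ^ r) ^ 2 := by
        linear_combination gam α 1 ^ (2 * r + 1) * hgsq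
      have e2 : (α * gam α 1 - p : ℝ)
          = α * gam α 1 * (1 - ((α : ℝ) * gam α 1)⁻¹ * p) := by
        field_simp
      rw [e1, e2]
      have hDne : (gam α 1 - lam α 1) ^ 2 ≠ 0 := by positivity
      generalize (1 - ((α : ℝ) * gam α 1)⁻¹ * p) = z
      generalize (gam α 1 - lam α 1) ^ 2 = d at *
      field_simp
    rw [hid]
    -- Dividing the error coefficient of one level by γ - 1 sums the geometric series of errors; the
    -- extra γ covers r = 0.
    have hsucc : (gam α 1 + (8 * α ^ 2 * gam α 1 ^ 2 + α) / (gam α 1 - 1)) * gam α 1 ^ (r + 1)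
        = (gam α 1 + (8 * α ^ 2 * gam α 1 ^ 2 + α) / (gam α 1 - 1)) * gam α 1 ^ r
          + (8 * α ^ 2 * gam α 1 ^ 2 + α) * gam α 1 ^ r
          + gam α 1 * (gam α 1 - 1) * gam α 1 ^ r := by
      have : gam α 1 - 1 ≠ 0 := by linarith
      field_simp
      ring
    have h0 : 0 ≤ gam α 1 * (gam α 1 - 1) * gam α 1 ^ r :=
      mul_nonneg (mul_nonneg (by linarith) (by linarith)) (by positivity)
    rw [hsucc]
    rw [abs_le] at ih hstep ⊢
    constructor <;> linarith [ih.1, ih.2, hstep.1, hstep.2]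

/-! ### The density estimate -/

/-- For r ≤ -1 the number under the floor is at most α / (α² + 4) < 1. -/
theorem nonneg_of_one_le_nCR {α : ℕ} (hα : 1 ≤ α) {c : ℝ}
    (hc : c ≤ α * gam α 1) {r : ℤ} (h : 1 ≤ nCR α 1 c r) : 0 ≤ r := by
  by_contra hr
  have hα' : (1 : ℝ) ≤ α := by exact_mod_cast hα
  have hg := one_lt_gam hα
  have hD := gam_sub_lam_sq α
  unfold nCR at h
  rw [Nat.one_le_floor_iff] at h
  have h1 : gam α 1 ^ (2 * r + 1) ≤ gam α 1 ^ (-1 : ℤ) := zpow_le_zpow_right₀ hg.le (by omega)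
  have h2 : c * gam α 1 ^ (2 * r + 1) ≤ α * gam α 1 * gam α 1 ^ (-1 : ℤ) := by gcongr
  rw [zpow_neg_one, mul_inv_cancel_right₀ (by linarith)] at h2
  rw [hD, Nat.cast_one, mul_one, div_mul_eq_mul_div, le_div_iff₀ (by positivity)] at h
  nlinarith

theorem abs_proportion_sub_le {α p : ℕ} (hα : 1 ≤ α) (hp : p ≤ α ^ 2) {c : ℝ}
    (hc1 : 1 ≤ c) (hc : c ≤ p * gam α 1 / α) {r : ℤ} (hr : 1 ≤ nCR α 1 c r) :
    |proportion α 1 p (nCR α 1 c r)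
        - 1 / 2 * c⁻¹ * (1 - ((α : ℝ) * gam α 1)⁻¹ * (p : ℝ)) ^ 2|
      ≤ 2 * ((α : ℝ) ^ 2 + 4) * (gam α 1 + (8 * α ^ 2 * gam α 1 ^ 2 + α) / (gam α 1 - 1) + α + 2)
        * gam α 1 ^ (-r) := by
  have hα' : (1 : ℝ) ≤ α := by exact_mod_cast hα
  have hg := one_lt_gam hα
  have hp' : (p : ℝ) ≤ α ^ 2 := by exact_mod_cast hp
  have hp0 : (0 : ℝ) ≤ p := Nat.cast_nonneg p
  have hD := gam_sub_lam_sq α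
  have hαg := lt_gam α
  have hc2 : c ≤ α * gam α 1 := by
    refine hc.trans ?_
    rw [div_le_iff₀ (by positivity)]
    nlinarith
  obtain ⟨r, rfl⟩ := Int.eq_ofNat_of_zero_le (nonneg_of_one_le_nCR hα hc2 hr)
  have hsum := abs_sum_card_triangle_sub_le hα hp r
  have hup := lucasSeq_mul_succ_le hα r
  have hlo := le_lucasSeq_mul_add_two α r
  have hD0 : 0 < (gam α 1 - lam α 1) ^ 2 := by rw [hD]; positivity
  set N := nCR α 1 c r with hN
  set X : ℝ := c * gam α 1 ^ (2 * r + 1) / (gam α 1 - lam α 1) ^ 2 with hX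
  have hNX : N = ⌊X⌋₊ := by
    rw [hN, nCR, hX, Nat.cast_one, mul_one, div_mul_eq_mul_div]
    norm_cast
  have hX0 : 0 ≤ X := by positivity
  have hN1 : (N : ℝ) ≤ X := by rw [hNX]; exact Nat.floor_le hX0
  have hN2 : X < N + 1 := by rw [hNX]; exact Nat.lt_floor_add_one X
  have hN3 : (1 : ℝ) ≤ N := by exact_mod_cast hr
  have hgX : gam α 1 ^ (2 * r + 1) / (gam α 1 - lam α 1) ^ 2 ≤ X := by
    rw [hX]; gcongr; exact le_mul_of_one_le_left (by positivity) hc1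
  have hup' : lucasSeq α r * lucasSeq α (r + 1) ≤ N + 1 := by
    have : (lucasSeq α r * lucasSeq α (r + 1) : ℝ) < ((N + 1 + 1 : ℕ) : ℝ) := by
      push_cast; linarith
    have : lucasSeq α r * lucasSeq α (r + 1) < N + 1 + 1 := by exact_mod_cast this
    omega
  have hlow : ∀ n, n ≤ N → p * lucasSeq α r * lucasSeq α (r + 2) ≤ α * n → N ≤ n + α := by
    intro n _ hn
    have hn' : (p : ℝ) * (lucasSeq α r * lucasSeq α (r + 2)) ≤ α * n := by
      rw [← mul_assoc]; exact_mod_cast hn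
    -- Here c ≤ pγ/α enters. The loss of p from `hlo` is at most α², which after division by α gives
    -- the slack α.
    have h1 : (α : ℝ) * X
        ≤ p * (gam α 1 ^ (2 * r + 2) / (gam α 1 - lam α 1) ^ 2) := by
      rw [le_div_iff₀ (by positivity)] at hc
      have : (α : ℝ) * X = c * α * (gam α 1 ^ (2 * r + 1) / (gam α 1 - lam α 1) ^ 2) := by
        rw [hX]; ring
      rw [this]
      calc _ ≤ p * gam α 1 * (gam α 1 ^ (2 * r + 1) / (gam α 1 - lam α 1) ^ 2) := by gcongr
        _ = _ := by ring
    have h2 := mul_le_mul_of_nonneg_left hlo hp0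
    have h3 : (α : ℝ) * N ≤ α * (n + α) := by nlinarith
    have h4 : (N : ℝ) ≤ n + α := le_of_mul_le_mul_left h3 (by linarith)
    exact_mod_cast h4
  have hcount := abs_ncard_sub_sum_le hα hup' hlow
  rw [proportion]
  set M : ℝ := 1 / 2 * c⁻¹ * (1 - ((α : ℝ) * gam α 1)⁻¹ * (p : ℝ)) ^ 2 with hM
  have hXM : (1 - ((α : ℝ) * gam α 1)⁻¹ * p) ^ 2 / (2 * (gam α 1 - lam α 1) ^ 2)
        * gam α 1 ^ (2 * r + 1) = X * M := by
    have hDne := hD0.ne'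
    rw [hX, hM]
    generalize (1 - ((α : ℝ) * gam α 1)⁻¹ * (p : ℝ)) = z
    generalize (gam α 1 - lam α 1) ^ 2 = d at *
    field_simp
  rw [hXM] at hsum
  have hM0 : 0 ≤ M := by positivity
  have hM1 : M ≤ 1 := by
    have h1 : ((α : ℝ) * gam α 1)⁻¹ * p ≤ 1 := by
      rw [inv_mul_le_iff₀ (by positivity)]; nlinarith
    have h2 : 0 ≤ ((α : ℝ) * gam α 1)⁻¹ * p := by positivity
    have h3 : (1 - ((α : ℝ) * gam α 1)⁻¹ * p) ^ 2 ≤ 1 := by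
      apply pow_le_one₀ <;> linarith
    have h4 : c⁻¹ ≤ 1 := inv_le_one_of_one_le₀ hc1
    have h5 : 0 ≤ c⁻¹ := by positivity
    rw [hM]
    nlinarith [mul_le_mul h4 h3 (by positivity) zero_le_one]
  set K : ℝ := gam α 1 + (8 * α ^ 2 * gam α 1 ^ 2 + α) / (gam α 1 - 1) with hK
  have hK0 : 0 ≤ K := by
    have : 0 ≤ (8 * α ^ 2 * gam α 1 ^ 2 + α) / (gam α 1 - 1) :=
      div_nonneg (by positivity) (by linarith)
    linarith
  set T : ℝ := ((S α 1 p ∩ Set.Icc 1 N).ncard : ℝ) with hT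
  have hgr : 1 ≤ gam α 1 ^ r := one_le_pow₀ hg.le
  have hTN : |T - N * M| ≤ (K + α + 2) * gam α 1 ^ r := by
    have e1 : |(X - N) * M| ≤ 1 := by
      rw [abs_of_nonneg (mul_nonneg (by linarith) hM0)]
      calc (X - N) * M ≤ 1 * 1 := mul_le_mul (by linarith) hM1 hM0 zero_le_one
        _ = 1 := one_mul 1
    rw [sub_mul] at e1
    rw [add_assoc K, add_mul]
    rw [abs_le] at e1 hsum hcount ⊢
    have e2 : (α : ℝ) + 2 ≤ (α + 2) * gam α 1 ^ r := le_mul_of_one_le_right (by positivity) hgr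
    constructor <;> linarith [e1.1, e1.2, hsum.1, hsum.2, hcount.1, hcount.2]
  -- N has order at least γ^{2r}, so an error γ^r in the count becomes γ^{-r} in the proportion; the
  -- 2 comes from X < N + 1 ≤ 2N.
  have hNinv : (N : ℝ)⁻¹ * gam α 1 ^ r ≤ 2 * ((α : ℝ) ^ 2 + 4) * gam α 1 ^ (-(r : ℤ)) := by
    rw [inv_mul_le_iff₀ (by linarith), zpow_neg, zpow_natCast]
    rw [← mul_assoc, le_mul_inv_iff₀ (by positivity)]
    have e1 : gam α 1 ^ (2 * r + 1) ≤ X * (α ^ 2 + 4) := by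
      rw [← hD]; rwa [div_le_iff₀ hD0] at hgX
    have e2 : gam α 1 ^ r * gam α 1 ^ r ≤ gam α 1 ^ (2 * r + 1) := by
      rw [← pow_add, ← two_mul]; exact pow_le_pow_right₀ hg.le (by omega)
    have e3 : X * ((α : ℝ) ^ 2 + 4) ≤ 2 * N * (α ^ 2 + 4) := by gcongr; linarith
    linarith
  have hfin : (N : ℝ)⁻¹ * T - M = (N : ℝ)⁻¹ * (T - N * M) := by
    field_simp
  rw [hfin, abs_mul, abs_of_nonneg (by positivity)]
  calc (N : ℝ)⁻¹ * |T - N * M| ≤ (N : ℝ)⁻¹ * ((K + α + 2) * gam α 1 ^ r) := by gcongr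
    _ = (K + α + 2) * ((N : ℝ)⁻¹ * gam α 1 ^ r) := by ring
    _ ≤ (K + α + 2) * (2 * ((α : ℝ) ^ 2 + 4) * gam α 1 ^ (-(r : ℤ))) := by gcongr
    _ = _ := by ring

end SlowWalk

theorem mainTheorem6 (α : ℕ) (hα : 1 ≤ α) :
    ∃ C : ℝ, 0 < C ∧
      (∀ p : ℕ, 1 ≤ p → p ≤ α ^ 2 →
        ∀ c : ℝ, 1 ≤ c → c ≤ (p : ℝ) * SlowWalk.gam α 1 / (α : ℝ) →
        ∀ r : ℤ, 1 ≤ SlowWalk.nCR α 1 c r →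
          |SlowWalk.proportion α 1 p (SlowWalk.nCR α 1 c r)
              - 1 / 2 * c⁻¹ * (1 - ((α : ℝ) * SlowWalk.gam α 1)⁻¹ * (p : ℝ)) ^ 2|
            ≤ C * SlowWalk.gam α 1 ^ (-r)) ∧
      (∀ c : ℝ, 1 ≤ c → c ≤ (α : ℝ) * SlowWalk.gam α 1 →
        ∀ r : ℤ, 1 ≤ SlowWalk.nCR α 1 c r →
          |SlowWalk.proportion α 1 (α ^ 2) (SlowWalk.nCR α 1 c r)
              - 1 / 2 * c⁻¹ * SlowWalk.gam α 1 ^ (-4 : ℤ)|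
            ≤ C * SlowWalk.gam α 1 ^ (-r)) := by
  have hα' : (1 : ℝ) ≤ α := by exact_mod_cast hα
  have hg := SlowWalk.one_lt_gam hα
  have hK : 0 ≤ (8 * (α : ℝ) ^ 2 * SlowWalk.gam α 1 ^ 2 + α) / (SlowWalk.gam α 1 - 1) :=
    div_nonneg (by positivity) (by linarith)
  refine ⟨2 * ((α : ℝ) ^ 2 + 4) * (SlowWalk.gam α 1
    + (8 * α ^ 2 * SlowWalk.gam α 1 ^ 2 + α) / (SlowWalk.gam α 1 - 1) + α + 2), by positivity,
    fun p _ hp c hc1 hc r hr => SlowWalk.abs_proportion_sub_le hα hp hc1 hc hr,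
    fun c hc1 hc r hr => ?_⟩
  have h := SlowWalk.abs_proportion_sub_le (p := α ^ 2) hα le_rfl hc1
    (hc.trans_eq (by push_cast; field_simp)) hr
  have hpow : (1 - ((α : ℝ) * SlowWalk.gam α 1)⁻¹ * ((α ^ 2 : ℕ) : ℝ)) ^ 2
      = SlowWalk.gam α 1 ^ (-4 : ℤ) := by
    -- This is 1 - α/γ = γ^{-2}, the quadratic equation of γ divided by γ².
    have h1 : 1 - ((α : ℝ) * SlowWalk.gam α 1)⁻¹ * ((α ^ 2 : ℕ) : ℝ)
        = (SlowWalk.gam α 1 ^ 2)⁻¹ := by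
      push_cast
      field_simp
      linear_combination SlowWalk.gam_sq α
    rw [h1, inv_pow, ← pow_mul, zpow_neg]
    norm_cast
  rwa [hpow] at h
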